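/- Consider a finite sporadic task system on one processor: the jobs of task $\tau_i$ are released at least $T_i>0$ time units apart, each job needs at most $C_i>0$ time units of execution, and $U_i=C_i/T_i$. It is scheduled by preemptive fixed-priority scheduling (tasks have distinct priorities, in no assumed relation to the periods; at every time the ready job of the highest-priority task is executed, jobs of the same task in release order; deadlines play no role). Let $\tau_1,\dots,\tau_{k-1}$ ($k\ge 1$) be all the tasks of higher priority than $\tau_k$, indexed in non-increasing order of their periods, $T_1\ge T_2\ge\dots\ge T_{k-1}$; there may also be tasks of lower priority. Suppose that $\sum_{i=1}^{k}U_i\le 1$. Then the worst-case response time of $\tau_k$, that is, the supremum of (finishing time minus release time) over all jobs of $\tau_k$ in all legal job sequences, is at most $$B_k=\frac{C_k+\sum_{i=1}^{k-1}C_i-\sum_{i=1}^{k-1}U_i\sum_{\ell=i}^{k-1}C_\ell}{1-\sum_{i=1}^{k-1}U_i}.$$ Moreover, $B_k$ is tighter than the bound of Bini et al., $$B_k\le\frac{C_k+\sum_{i=1}^{k-1}C_i-\sum_{i=1}^{k-1}U_iC_i}{1-\sum_{i=1}^{k-1}U_i},$$ with strict inequality if $k-1\ge 2$. -/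

import Mathlib

open MeasureTheory

/-- A sporadic task system of `n` tasks on one processor under fixed-priority scheduling.
Task `i` has worst-case execution time `C i` and period (minimum inter-release time) `T i`.
Priority levels are distinct, a smaller value of `prio` meaning a higher priority; no relation
between priorities and periods is assumed. -/
structure TaskSystem (n : ℕ) where
  C : Fin n → ℝ
  T : Fin n → ℝ
  prio : Fin n → ℕ
  C_pos : ∀ i, 0 < C i
  T_pos : ∀ i, 0 < T i
  prio_injective : Function.Injective prio

namespace TaskSystem

variable {n : ℕ}

/-- Utilization of a task. -/
noncomputable def U (τ : TaskSystem n) (i : Fin n) : ℝ := τ.C i / τ.T i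

/-- The tasks with higher priority than task `k`. -/
def hp (τ : TaskSystem n) (k : Fin n) : Set (Fin n) := {i | τ.prio i < τ.prio k}

/-- A legal job sequence of a sporadic task system: `release i j` and `exec i j` are the release
time and the actual execution time of the `j`-th job (counted from `0`) of task `i`. -/
structure JobSequence (τ : TaskSystem n) where
  release : Fin n → ℕ → ℝ
  exec : Fin n → ℕ → ℝ
  exec_pos : ∀ i j, 0 < exec i j
  exec_le : ∀ i j, exec i j ≤ τ.C i
  separated : ∀ i j, release i j + τ.T i ≤ release i (j + 1)

/-- `τ.Precedes a b`: job `a` has precedence over job `b`, because its task has a higher priority,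
or because it is an earlier job of the same task. A job `(i, j)` is the `j`-th job of task `i`. -/
def Precedes (τ : TaskSystem n) (a b : Fin n × ℕ) : Prop :=
  τ.prio a.1 < τ.prio b.1 ∨ (a.1 = b.1 ∧ a.2 < b.2)

namespace JobSequence

variable {τ : TaskSystem n}

/-- A schedule `run` gives the job that the processor executes at each time (`none` if it idles).
`J.service run a t` is the amount of execution that job `a` has received before time `t`. -/
noncomputable def service (J : JobSequence τ) (run : ℝ → Option (Fin n × ℕ))
    (a : Fin n × ℕ) (t : ℝ) : ℝ :=
  volume.real (Set.Ico (J.release a.1 a.2) t ∩ {s | run s = some a})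

/-- Job `a` is ready at time `t`: it has been released and it is not finished. -/
def Ready (J : JobSequence τ) (run : ℝ → Option (Fin n × ℕ)) (a : Fin n × ℕ) (t : ℝ) : Prop :=
  J.release a.1 a.2 ≤ t ∧ J.service run a t < J.exec a.1 a.2

/-- `run` is the preemptive fixed-priority schedule of the job sequence: at every time the
processor executes the ready job that has precedence over all other ready jobs, and it idles only
if no job is ready. -/
structure IsFixedPrioritySchedule (J : JobSequence τ) (run : ℝ → Option (Fin n × ℕ)) : Prop where
  measurable : ∀ a, MeasurableSet {s | run s = some a}
  idle : ∀ t, run t = none → ∀ a, ¬ J.Ready run a t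
  ready : ∀ t a, run t = some a → J.Ready run a t
  highest : ∀ t a, run t = some a → ∀ b, J.Ready run b t → b ≠ a → τ.Precedes a b

/-- The finishing time of a job: the first time at which it has received its execution time
(`⊤` if it never finishes). -/
noncomputable def finishingTime (J : JobSequence τ) (run : ℝ → Option (Fin n × ℕ))
    (a : Fin n × ℕ) : EReal :=
  sInf ((fun t : ℝ => (t : EReal)) ''
    {t | J.release a.1 a.2 ≤ t ∧ J.exec a.1 a.2 ≤ J.service run a t})

/-- The response time of a job: its finishing time minus its release time. -/
noncomputable def responseTime (J : JobSequence τ) (run : ℝ → Option (Fin n × ℕ))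
    (a : Fin n × ℕ) : EReal :=
  J.finishingTime run a - ((J.release a.1 a.2 : ℝ) : EReal)

end JobSequence

/-- The worst-case response time of task `k`: the supremum of the response times of all its jobs,
in the fixed-priority schedules of all legal job sequences. -/
noncomputable def worstCaseResponseTime (τ : TaskSystem n) (k : Fin n) : EReal :=
  ⨆ (J : JobSequence τ) (run : ℝ → Option (Fin n × ℕ)) (_ : J.IsFixedPrioritySchedule run)
    (j : ℕ), J.responseTime run (k, j)

/-- The response-time bound of task `k`, for an enumeration `σ` of its higher-priority tasks. -/
noncomputable def responseBound (τ : TaskSystem n) (k : Fin n) {m : ℕ} (σ : Fin m ≃ τ.hp k) : ℝ :=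
  (τ.C k + ∑ i, τ.C (σ i) - ∑ i, τ.U (σ i) * ∑ l ∈ Finset.Ici i, τ.C (σ l)) /
    (1 - ∑ i, τ.U (σ i))

/-- The earlier response-time bound of Bini et al. -/
noncomputable def biniBound (τ : TaskSystem n) (k : Fin n) {m : ℕ} (σ : Fin m ≃ τ.hp k) : ℝ :=
  (τ.C k + ∑ i, τ.C (σ i) - ∑ i, τ.U (σ i) * τ.C (σ i)) / (1 - ∑ i, τ.U (σ i))

end TaskSystem

namespace TaskSystem

variable {n : ℕ}

/-! Let a job of task k be unfinished at time t. Its busy window starts at a time t₀ with no pending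
work of k's priority or higher (`exists_busy_window`). Let d be the job's release minus t₀, q the
number of jobs of k released from t₀ up to it, and g_i the offset from t₀ of the last release of
task i before t.

In the window, task i releases at most C_i + U_i g_i of work, and at least C_i less strictly before
its last release. As the processor never idles, g_j ≤ q C_k + ∑ (U_i g_i + [g_i < g_j] C_i), and t -
t₀ < q C_k + ∑ (U_i g_i + C_i). Weighting the first inequality by U_j and summing bounds ∑ U_j g_j,
because ∑ U_j < 1. The term ∑ U_j ∑ [g_i < g_j] C_i depends only on the order of the last releases
and is largest for non-increasing periods (`sum_U_mul_sum_C_le`). The earlier jobs of k cost at most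
U_k d ≤ (1 - ∑ U_i) d, which is absorbed on passing from t - t₀ to t - t₀ - d. -/

lemma U_pos (τ : TaskSystem n) (i : Fin n) : 0 < τ.U i := div_pos (τ.C_pos i) (τ.T_pos i)

lemma U_mul_T (τ : TaskSystem n) (i : Fin n) : τ.U i * τ.T i = τ.C i :=
  div_mul_cancel₀ _ (τ.T_pos i).ne'

/-- Both sides are U_i U_j times a period. This decides which order of two tasks is worse. -/
lemma U_mul_C_le (τ : TaskSystem n) {i j : Fin n} (h : τ.T j ≤ τ.T i) :
    τ.U i * τ.C j ≤ τ.U j * τ.C i := by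
  have hi := τ.U_mul_T i
  have hj := τ.U_mul_T j
  rw [← hi, ← hj]
  nlinarith [mul_pos (τ.U_pos i) (τ.U_pos j)]

/-! ### Releases of sporadic jobs and the service they receive -/

namespace JobSequence

variable {τ : TaskSystem n} (J : JobSequence τ)

lemma release_add_mul_le (i : Fin n) (p d : ℕ) :
    J.release i p + d * τ.T i ≤ J.release i (p + d) := by
  induction d with
  | zero => simp
  | succ d ih =>
    have := J.separated i (p + d)
    rw [← add_assoc]
    push_cast
    linarith

lemma release_strictMono (i : Fin n) : StrictMono (J.release i) :=
  strictMono_nat_of_lt_succ fun p => by linarith [J.separated i p, τ.T_pos i]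

lemma finite_setOf_release_le (t : ℝ) : {a : Fin n × ℕ | J.release a.1 a.2 ≤ t}.Finite := by
  have h : ∀ i, {p : ℕ | J.release i p ≤ t}.Finite := fun i => by
    obtain ⟨N, hN⟩ := exists_nat_gt ((t - J.release i 0) / τ.T i)
    rw [div_lt_iff₀ (τ.T_pos i)] at hN
    refine (Set.finite_lt_nat N).subset fun p (hp : _ ≤ t) => ?_
    by_contra hNp
    have hNp : N ≤ p := not_lt.1 hNp
    have h0 := J.release_add_mul_le i 0 N
    have h1 := (J.release_strictMono i).monotone hNp
    rw [zero_add] at h0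
    linarith
  refine (Set.finite_iUnion fun i => (h i).image (Prod.mk i)).subset ?_
  rintro ⟨i, p⟩ hp
  exact Set.mem_iUnion.2 ⟨i, p, hp, rfl⟩

lemma finite_setOf_release_mem_Ico (i : Fin n) (s t : ℝ) :
    {p : ℕ | s ≤ J.release i p ∧ J.release i p < t}.Finite :=
  ((J.finite_setOf_release_le t).preimage (f := Prod.mk i)
    (Prod.mk_right_injective i).injOn).subset fun _ hp => hp.2.le

/-- The indices of the jobs of task `i` that are released in `[s, t)`. -/
noncomputable def released (i : Fin n) (s t : ℝ) : Finset ℕ :=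
  (J.finite_setOf_release_mem_Ico i s t).toFinset

lemma mem_released {i : Fin n} {s t : ℝ} {p : ℕ} :
    p ∈ J.released i s t ↔ s ≤ J.release i p ∧ J.release i p < t := by
  simp [released]

/-- Jobs of one task that are released in `[s, t]` number at most `1 + (t - s) / T`. -/
lemma card_mul_C_le (i : Fin n) {s t : ℝ} {F : Finset ℕ} (hF : F.Nonempty)
    (h : ∀ p ∈ F, s ≤ J.release i p ∧ J.release i p ≤ t) :
    (F.card : ℝ) * τ.C i ≤ τ.C i + τ.U i * (t - s) := by
  -- The extreme indices differ by some d, so there are at most d + 1 jobs, while d periods fit into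
  -- [s, t].
  have hsub : F ⊆ Finset.Icc (F.min' hF) (F.max' hF) := fun p hp =>
    Finset.mem_Icc.2 ⟨F.min'_le p hp, F.le_max' p hp⟩
  have hcard := Finset.card_le_card hsub
  have hle : F.min' hF ≤ F.max' hF := F.min'_le_max' hF
  rw [Nat.card_Icc] at hcard
  obtain ⟨d, hd⟩ := Nat.exists_eq_add_of_le hle
  have hcd : (F.card : ℝ) ≤ d + 1 := by exact_mod_cast (by omega : F.card ≤ d + 1)
  have h1 := J.release_add_mul_le i (F.min' hF) d
  rw [← hd] at h1
  have h2 := (h _ (F.min'_mem hF)).1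
  have h3 := (h _ (F.max'_mem hF)).2
  have h4 : τ.U i * (d * τ.T i) ≤ τ.U i * (t - s) :=
    mul_le_mul_of_nonneg_left (by linarith) (τ.U_pos i).le
  have h5 : τ.U i * (d * τ.T i) = d * τ.C i := by rw [← τ.U_mul_T i]; ring
  nlinarith [mul_le_mul_of_nonneg_right hcd (τ.C_pos i).le]

variable {J} {run : ℝ → Option (Fin n × ℕ)}

lemma measure_Ico_inter_ne_top (x y : ℝ) (A : Set ℝ) : volume (Set.Ico x y ∩ A) ≠ ⊤ :=
  measure_ne_top_of_subset Set.inter_subset_left measure_Ico_lt_top.ne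

lemma service_mono (a : Fin n × ℕ) : Monotone (J.service run a) := fun _ _ h =>
  measureReal_mono (Set.inter_subset_inter_left _ (Set.Ico_subset_Ico_right h))
    (measure_Ico_inter_ne_top _ _ _)

lemma service_le_add (a : Fin n × ℕ) (u v : ℝ) :
    J.service run a v ≤
      J.service run a u + volume.real (Set.Ico u v ∩ {s | run s = some a}) := by
  refine (measureReal_mono ?_ ?_).trans (measureReal_union_le _ _)
  · rintro x ⟨⟨h1, h2⟩, h3⟩
    rcases lt_or_ge x u with h | h
    · exact Or.inl ⟨⟨h1, h⟩, h3⟩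
    · exact Or.inr ⟨⟨h, h2⟩, h3⟩
  · exact measure_union_ne_top (measure_Ico_inter_ne_top _ _ _) (measure_Ico_inter_ne_top _ _ _)

lemma continuous_service (a : Fin n × ℕ) : Continuous (J.service run a) := by
  refine (LipschitzWith.of_le_add fun v u => ?_).continuous
  refine (service_le_add a u v).trans (add_le_add_right ?_ _)
  refine (measureReal_mono Set.inter_subset_left measure_Ico_lt_top.ne).trans ?_
  rw [Real.volume_real_Ico, Real.dist_eq]
  exact max_le (le_abs_self _) (abs_nonneg _)

lemma service_release (a : Fin n × ℕ) : J.service run a (J.release a.1 a.2) = 0 := by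
  simp [service]

/-! ### Consequences of the scheduling rule -/

namespace IsFixedPrioritySchedule

variable (hrun : J.IsFixedPrioritySchedule run)
include hrun

/-- By continuity, excess service would pass through the execution time; from then on the job is not
ready and cannot run. -/
lemma service_le_exec (a : Fin n × ℕ) (t : ℝ) : J.service run a t ≤ J.exec a.1 a.2 := by
  by_contra! h
  have hr : J.release a.1 a.2 ≤ t := by
    by_contra! hlt
    have := service_mono (J := J) (run := run) a hlt.le
    rw [service_release] at this
    linarith [J.exec_pos a.1 a.2]
  obtain ⟨u, hu, hue⟩ := intermediate_value_Icc hr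
    (continuous_service (J := J) (run := run) a).continuousOn
    (show J.exec a.1 a.2 ∈ _ from ⟨by rw [service_release]; exact (J.exec_pos _ _).le, h.le⟩)
  have hempty : Set.Ico u t ∩ {s | run s = some a} = ∅ := by
    refine Set.eq_empty_of_forall_notMem fun s hs => ?_
    have h1 := (hrun.ready s a hs.2).2
    have h2 := service_mono (J := J) (run := run) a hs.1.1
    linarith
  have := service_le_add (J := J) (run := run) a u t
  rw [hempty, measureReal_empty] at this
  linarith

lemma service_le_C (a : Fin n × ℕ) (t : ℝ) : J.service run a t ≤ τ.C a.1 :=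
  (hrun.service_le_exec a t).trans (J.exec_le _ _)

/-- Before a job of task `k` finishes, its busy window starts at a time `t₀` such that from `t₀` on
only jobs released since `t₀`, of tasks of higher priority than `k` or jobs of `k` up to the given
one, are executed, and the processor never idles. -/
lemma exists_busy_window {k : Fin n} {j : ℕ} {t : ℝ}
    (hunf : J.service run (k, j) t < J.exec k j) :
    ∃ t₀ ≤ J.release k j, ∀ s, t₀ ≤ s → s < t → ∃ a, run s = some a ∧ t₀ ≤ J.release a.1 a.2 ∧
      J.release a.1 a.2 ≤ s ∧ (τ.prio a.1 < τ.prio k ∨ (a.1 = k ∧ a.2 ≤ j)) := by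
  set r := J.release k j with hr
  let A : Set (Fin n × ℕ) := {a | τ.prio a.1 ≤ τ.prio k ∧ J.release a.1 a.2 ≤ r}
  -- `P s`: no backlog of priority at least that of k at time s. It holds vacuously at the earliest
  -- relevant release; t₀ will be the latest release up to r at which it holds.
  let P : ℝ → Prop := fun s => ∀ a : Fin n × ℕ, τ.prio a.1 ≤ τ.prio k →
    J.release a.1 a.2 < s → J.exec a.1 a.2 ≤ J.service run a s
  have hA : A.Finite := (J.finite_setOf_release_le r).subset fun a ha => ha.2
  obtain ⟨a₁, ha₁, hmin⟩ := hA.exists_minimalFor (fun a => J.release a.1 a.2) A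
    ⟨(k, j), le_rfl, le_rfl⟩
  have hP₁ : P (J.release a₁.1 a₁.2) := fun a hak hlt => by
    have := hmin (j := a) ⟨hak, hlt.le.trans ha₁.2⟩ hlt.le
    exact absurd hlt (not_lt.2 this)
  obtain ⟨a₀, ha₀, hmax⟩ := (hA.subset (Set.sep_subset A fun a => P (J.release a.1 a.2)))
    |>.exists_maximalFor (fun a => J.release a.1 a.2) _ ⟨a₁, ha₁, hP₁⟩
  refine ⟨J.release a₀.1 a₀.2, ha₀.1.2, fun s h0s hst => ?_⟩
  have hnotdone : ¬ ∀ a : Fin n × ℕ, τ.prio a.1 ≤ τ.prio k → ¬ J.Ready run a s := by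
    intro hall
    have hdone : ∀ a : Fin n × ℕ, τ.prio a.1 ≤ τ.prio k → J.release a.1 a.2 ≤ s →
        J.exec a.1 a.2 ≤ J.service run a s := fun a hak has => by
      by_contra! hlt
      exact hall a hak ⟨has, hlt⟩
    have hsr : s < r := by
      by_contra! hle
      have h1 := hdone (k, j) le_rfl hle
      have h2 := service_mono (J := J) (run := run) (k, j) hst.le
      exact absurd hunf (not_lt.2 (h1.trans h2))
    -- If nothing relevant is ready at s < r, the next relevant release again has no backlog,
    -- against the maximality of t₀.
    obtain ⟨b, hb, hbmin⟩ := (hA.subset (Set.sep_subset A fun a => s < J.release a.1 a.2))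
      |>.exists_minimalFor (fun a => J.release a.1 a.2) _ ⟨(k, j), ⟨le_rfl, le_rfl⟩, hsr⟩
    have hPb : P (J.release b.1 b.2) := fun a hak hlt => by
      have has : J.release a.1 a.2 ≤ s := by
        by_contra! hsa
        exact absurd hlt (not_lt.2 (hbmin (j := a) ⟨⟨hak, hlt.le.trans hb.1.2⟩, hsa⟩ hlt.le))
      exact (hdone a hak has).trans (service_mono a hb.2.le)
    have := hmax (j := b) ⟨hb.1, hPb⟩ (h0s.trans hb.2.le)
    exact absurd hb.2 (not_lt.2 (le_trans this h0s))
  push Not at hnotdone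
  obtain ⟨b, hbk, hb⟩ := hnotdone
  obtain ⟨a, ha⟩ : ∃ a, run s = some a := by
    rcases h : run s with _ | a
    · exact absurd hb (hrun.idle s h b)
    · exact ⟨a, rfl⟩
  have hready := hrun.ready s a ha
  have hak : τ.prio a.1 ≤ τ.prio k := by
    by_cases hba : b = a
    · rwa [← hba]
    · rcases hrun.highest s a ha b hb hba with h | h
      · exact h.le.trans hbk
      · rwa [h.1]
  refine ⟨a, ha, ?_, hready.1, ?_⟩
  · by_contra! hlt
    have h1 := ha₀.2 a hak hlt
    have h2 := service_mono (J := J) (run := run) a h0s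
    exact absurd hready.2 (not_lt.2 (h1.trans h2))
  · rcases hak.lt_or_eq with h | h
    · exact Or.inl h
    · have hk := τ.prio_injective h
      refine Or.inr ⟨hk, ?_⟩
      by_contra! hlt
      have hrs : r ≤ s := by
        refine le_trans ?_ hready.1
        rw [hk]
        exact (J.release_strictMono k).monotone hlt.le
      have hj : J.Ready run (k, j) s := ⟨hrs, (service_mono (k, j) hst.le).trans_lt hunf⟩
      have hne : ((k, j) : Fin n × ℕ) ≠ a := by
        rintro rfl
        exact lt_irrefl _ hlt
      rcases hrun.highest s a ha _ hj hne with h' | h'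
      · exact absurd h' (by simp [hk])
      · exact absurd h'.2 (not_lt.2 hlt.le)

end IsFixedPrioritySchedule

/-- If only the jobs of a finite set, released since `t₀`, are executed in `[t₀, s)`, then the
length of the interval is at most the service that they receive. -/
lemma sub_le_sum_service {t₀ s : ℝ} (F : Finset (Fin n × ℕ))
    (h : ∀ x, t₀ ≤ x → x < s → ∃ a ∈ F, run x = some a ∧ J.release a.1 a.2 ≤ x) :
    s - t₀ ≤ ∑ a ∈ F, J.service run a s := by
  refine le_trans ?_ (measureReal_biUnion_finset_le F _)
  refine le_trans ?_ (measureReal_mono (s₁ := Set.Ico t₀ s) ?_ ?_)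
  · rw [Real.volume_real_Ico]
    exact le_max_left _ _
  · rintro x ⟨h1, h2⟩
    obtain ⟨a, haF, hax, har⟩ := h x h1 h2
    exact Set.mem_biUnion (t := fun a => _) haF ⟨⟨har, h2⟩, hax⟩
  · exact ((measure_biUnion_lt_top F.finite_toSet) fun a _ =>
      (measure_Ico_inter_ne_top _ _ _).lt_top).ne

end JobSequence

/-- Among all orders, the one by non-increasing periods maximizes the sum of the products of
utilizations with the execution times of the preceding tasks. -/
lemma sum_U_mul_sum_C_le (τ : TaskSystem n) {m : ℕ} (f : Fin m → Fin n)
    (hf : Antitone fun i => τ.T (f i)) (g : Fin m → ℝ) :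
    ∑ j, τ.U (f j) * ∑ i, (if g i < g j then τ.C (f i) else 0) ≤
      ∑ j, τ.U (f j) * ∑ i, (if i < j then τ.C (f i) else 0) := by
  simp only [Finset.mul_sum]
  set F : Fin m → Fin m → ℝ := fun j i => τ.U (f j) * (if g i < g j then τ.C (f i) else 0)
    with hF
  set H : Fin m → Fin m → ℝ := fun j i => τ.U (f j) * (if i < j then τ.C (f i) else 0)
    with hH
  -- Compare the two orders pair by pair: a tie contributes nothing, and an inversion costs no more
  -- than the order by periods.
  have key : ∀ i j, i < j → F j i + F i j ≤ H j i + H i j := fun i j hij => by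
    have h1 := τ.U_mul_C_le (hf hij.le)
    have h2 := mul_pos (τ.U_pos (f j)) (τ.C_pos (f i))
    simp only [hF, hH, hij, hij.not_gt, if_true, if_false, mul_zero]
    rcases lt_trichotomy (g i) (g j) with h | h | h
    · simp [h, h.not_gt]
    · simp [h, h2.le]
    · simpa [h, h.not_gt] using h1
  have hall : ∀ i j, F j i + F i j ≤ H j i + H i j := fun i j => by
    rcases lt_trichotomy i j with h | h | h
    · exact key i j h
    · simp [hF, hH, h]
    · linarith [key j i h]
  have h1 : ∑ j, ∑ i, (F j i + F i j) ≤ ∑ j, ∑ i, (H j i + H i j) :=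
    Finset.sum_le_sum fun j _ => Finset.sum_le_sum fun i _ => hall i j
  simp only [Finset.sum_add_distrib] at h1
  rw [Finset.sum_comm (f := fun j i => F i j), Finset.sum_comm (f := fun j i => H i j)] at h1
  linarith

/-! ### The bound, its comparison with Bini et al., and response times -/

section Bound

variable (τ : TaskSystem n) (k : Fin n) {m : ℕ} (σ : Fin m ≃ τ.hp k)

/-- Splitting ∑ C_i at j turns the tail sums into sums over preceding tasks, the form in which the
busy window yields them. -/
lemma responseBound_eq :
    τ.responseBound k σ = (τ.C k + (∑ j, τ.U (σ j) * ∑ i, (if i < j then τ.C (σ i) else 0)) +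
      (1 - ∑ i, τ.U (σ i)) * ∑ i, τ.C (σ i)) / (1 - ∑ i, τ.U (σ i)) := by
  rw [responseBound]
  congr 1
  have h : ∀ j : Fin m, ∑ i, τ.C (σ i) =
      ∑ i, (if i < j then τ.C (σ i) else 0) + ∑ l ∈ Finset.Ici j, τ.C (σ l) := fun j => by
    rw [← Finset.sum_filter, ← Finset.sum_filter_add_sum_filter_not _ (fun i => i < j)]
    congr 2
    ext i
    simp
  have h2 : (∑ j, τ.U (σ j)) * ∑ i, τ.C (σ i) =
      ∑ j, τ.U (σ j) * ∑ i, (if i < j then τ.C (σ i) else 0) +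
        ∑ j, τ.U (σ j) * ∑ l ∈ Finset.Ici j, τ.C (σ l) := by
    rw [Finset.sum_mul, ← Finset.sum_add_distrib]
    exact Finset.sum_congr rfl fun j _ => by rw [← mul_add, ← h j]
  linarith

variable {k} (hU : ∑ i, τ.U (σ i) + τ.U k ≤ 1)
include hU

lemma one_sub_sum_U_pos : 0 < 1 - ∑ i, τ.U (σ i) := by linarith [τ.U_pos k]

lemma responseBound_nonneg : 0 ≤ τ.responseBound k σ := by
  rw [responseBound_eq]
  have h := τ.one_sub_sum_U_pos σ hU
  have h1 : 0 ≤ ∑ j, τ.U (σ j) * ∑ i, (if i < j then τ.C (σ i) else 0) :=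
    Finset.sum_nonneg fun j _ => mul_nonneg (τ.U_pos _).le <| Finset.sum_nonneg fun i _ => by
      split_ifs
      exacts [(τ.C_pos _).le, le_rfl]
  have h2 : 0 ≤ ∑ i, τ.C (σ i) := Finset.sum_nonneg fun i _ => (τ.C_pos _).le
  have h3 := τ.C_pos k
  positivity

/-- The bound on the length of a busy window with `q` jobs of task `k`, given the offsets `g` of the
last releases of the tasks of higher priority. -/
lemma lt_responseBound_of_last_releases (hσ : Antitone fun i : Fin m => τ.T (σ i))
    {q L d : ℝ} (g : Fin m → ℝ)
    (hq : q * τ.C k ≤ τ.C k + τ.U k * d) (hd : 0 ≤ d)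
    (hg : ∀ j, g j ≤ q * τ.C k +
      ∑ i, (τ.U (σ i) * g i + if g i < g j then τ.C (σ i) else 0))
    (hL : L < q * τ.C k + ∑ i, (τ.U (σ i) * g i + τ.C (σ i))) :
    L - d < τ.responseBound k σ := by
  have hpos := τ.one_sub_sum_U_pos σ hU
  rw [responseBound_eq, lt_div_iff₀ hpos]
  simp only [Finset.sum_add_distrib] at hg hL
  set X := q * τ.C k + ∑ i, τ.U (σ i) * g i with hX
  have h1 : ∑ j, τ.U (σ j) * g j ≤
      (∑ j, τ.U (σ j)) * X + ∑ j, τ.U (σ j) * ∑ i, (if g i < g j then τ.C (σ i) else 0) := by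
    rw [Finset.sum_mul, ← Finset.sum_add_distrib]
    refine Finset.sum_le_sum fun j _ => ?_
    rw [← mul_add]
    exact mul_le_mul_of_nonneg_left (by linarith [hg j]) (τ.U_pos _).le
  have h2 := τ.sum_U_mul_sum_C_le (fun i => (σ i : Fin n)) hσ g
  have h3 : L * (1 - ∑ i, τ.U (σ i)) < (X + ∑ i, τ.C (σ i)) * (1 - ∑ i, τ.U (σ i)) :=
    mul_lt_mul_of_pos_right (by linarith) hpos
  -- Here the utilization of k itself is used.
  have h4 : τ.U k * d ≤ (1 - ∑ i, τ.U (σ i)) * d :=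
    mul_le_mul_of_nonneg_right (by linarith) hd
  linarith

lemma responseBound_le_biniBound : τ.responseBound k σ ≤ τ.biniBound k σ := by
  refine div_le_div_of_nonneg_right (sub_le_sub_left ?_ _) (τ.one_sub_sum_U_pos σ hU).le
  refine Finset.sum_le_sum fun i _ => mul_le_mul_of_nonneg_left ?_ (τ.U_pos _).le
  exact Finset.single_le_sum (f := fun l => τ.C (σ l)) (fun l _ => (τ.C_pos _).le)
    (Finset.mem_Ici.2 le_rfl)

lemma responseBound_lt_biniBound (hm : 2 ≤ m) : τ.responseBound k σ < τ.biniBound k σ := by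
  refine div_lt_div_of_pos_right (sub_lt_sub_left ?_ _) (τ.one_sub_sum_U_pos σ hU)
  refine Finset.sum_lt_sum (fun i _ => mul_le_mul_of_nonneg_left ?_ (τ.U_pos _).le)
    ⟨⟨0, by omega⟩, Finset.mem_univ _, mul_lt_mul_of_pos_left ?_ (τ.U_pos _)⟩
  · exact Finset.single_le_sum (f := fun l => τ.C (σ l)) (fun l _ => (τ.C_pos _).le)
      (Finset.mem_Ici.2 le_rfl)
  · exact Finset.single_lt_sum (f := fun l => τ.C (σ l)) (j := ⟨1, by omega⟩)
      (by simp [Fin.ext_iff]) (Finset.mem_Ici.2 le_rfl) (Finset.mem_Ici.2 (by simp [Fin.le_def]))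
      (τ.C_pos _) (fun l _ _ => (τ.C_pos _).le)

/-- A job of task `k` that is unfinished at time `t` was released less than `B_k` before `t`. -/
lemma sub_release_lt_responseBound (hσ : Antitone fun i : Fin m => τ.T (σ i))
    {J : JobSequence τ} {run : ℝ → Option (Fin n × ℕ)} (hrun : J.IsFixedPrioritySchedule run)
    {j : ℕ} {t : ℝ} (hrt : J.release k j ≤ t) (hunf : J.service run (k, j) t < J.exec k j) :
    t - J.release k j < τ.responseBound k σ := by
  classical
  obtain ⟨t₀, ht₀, hbusy⟩ := hrun.exists_busy_window hunf
  set S : Finset ℕ := (Finset.range (j + 1)).filter fun p => t₀ ≤ J.release k p with hS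
  have hjS : j ∈ S := by simp [hS, ht₀]
  let R : Fin m → ℝ → Finset ℕ := fun i s => J.released (σ i) t₀ s
  -- The default 0 is harmless: a task without releases contributes no work, and the estimates only
  -- need `0 ≤ g i`.
  let g : Fin m → ℝ := fun i =>
    if h : (R i t).Nonempty then J.release (σ i) ((R i t).max' h) - t₀ else 0
  have hgt : ∀ i, t₀ + g i ≤ t := fun i => by
    by_cases h : (R i t).Nonempty
    · have := J.mem_released.1 ((R i t).max'_mem h)
      simp only [g, dif_pos h]
      linarith
    · simp only [g, dif_neg h]
      linarith
  have hsub : ∀ i s, s ≤ t → R i s ⊆ R i t := fun i s hs p hp => by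
    have := J.mem_released.1 hp
    exact J.mem_released.2 ⟨this.1, this.2.trans_le hs⟩
  have hgnonneg : ∀ i, 0 ≤ g i := fun i => by
    by_cases h : (R i t).Nonempty
    · have := J.mem_released.1 ((R i t).max'_mem h)
      simp only [g, dif_pos h]
      linarith
    · simp only [g, dif_neg h]
      exact le_rfl
  have hcard : ∀ i, (R i t).Nonempty →
      ((R i t).card : ℝ) * τ.C (σ i) ≤ τ.C (σ i) + τ.U (σ i) * g i := fun i h => by
    have := J.card_mul_C_le (σ i) h (s := t₀) (t := J.release (σ i) ((R i t).max' h))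
      fun p hp => ⟨(J.mem_released.1 hp).1,
        (J.release_strictMono _).monotone ((R i t).le_max' p hp)⟩
    simpa only [g, dif_pos h] using this
  have hwork : ∀ s, s ≤ t → s - t₀ ≤ ∑ p ∈ S, J.service run (k, p) s +
      ∑ i, ((R i s).card : ℝ) * τ.C (σ i) := fun s hs => by
    let F : Finset (Fin n × ℕ) := S.image (Prod.mk k) ∪
      Finset.univ.biUnion fun i => (R i s).image (Prod.mk (σ i : Fin n))
    have hF := JobSequence.sub_le_sum_service (J := J) (run := run) (t₀ := t₀) (s := s) F
      fun x h0x hxs => by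
        obtain ⟨⟨i, p⟩, hax, h0a, hxa, hcase⟩ := hbusy x h0x (hxs.trans_le hs)
        refine ⟨(i, p), ?_, hax, hxa⟩
        simp only [F, Finset.mem_union, Finset.mem_image, Finset.mem_biUnion, Finset.mem_univ,
          true_and]
        rcases hcase with h | ⟨h, hp⟩
        · right
          refine ⟨σ.symm ⟨i, h⟩, p, J.mem_released.2 ?_, ?_⟩
          · simpa using ⟨h0a, hxa.trans_lt hxs⟩
          · simp
        · left
          simp only at h hp h0a
          subst h
          exact ⟨p, by simp [hS, h0a]; omega, rfl⟩
    have hnonneg : ∀ a, 0 ≤ J.service run a s := fun a => measureReal_nonneg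
    have hdisj : Set.PairwiseDisjoint (Finset.univ : Finset (Fin m)) fun i =>
        (R i s).image (Prod.mk (σ i : Fin n)) := fun i _ l _ hil => by
      refine Finset.disjoint_left.2 fun a ha hb => hil ?_
      obtain ⟨p, -, rfl⟩ := Finset.mem_image.1 ha
      obtain ⟨q, -, hq⟩ := Finset.mem_image.1 hb
      exact σ.injective (Subtype.ext (Prod.mk.inj hq).1.symm)
    have hsplit := Finset.sum_union_inter (s₁ := S.image (Prod.mk k))
      (s₂ := Finset.univ.biUnion fun i => (R i s).image (Prod.mk (σ i : Fin n)))
      (f := fun a => J.service run a s)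
    rw [Finset.sum_biUnion hdisj, Finset.sum_image (Prod.mk_right_injective k).injOn] at hsplit
    have hhp : ∑ i, ∑ a ∈ (R i s).image (Prod.mk (σ i : Fin n)), J.service run a s ≤
        ∑ i, ((R i s).card : ℝ) * τ.C (σ i) := by
      refine Finset.sum_le_sum fun i _ => ?_
      rw [Finset.sum_image (Prod.mk_right_injective _).injOn, ← nsmul_eq_mul]
      exact Finset.sum_le_card_nsmul _ _ _ fun p _ => hrun.service_le_C (σ i, p) _
    have hinter := Finset.sum_nonneg fun a (_ : a ∈ S.image (Prod.mk k) ∩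
      Finset.univ.biUnion fun i => (R i s).image (Prod.mk (σ i : Fin n))) => hnonneg a
    linarith
  have hd := J.card_mul_C_le k ⟨j, hjS⟩ (s := t₀) (t := J.release k j) fun p hp => by
    simp only [hS, Finset.mem_filter, Finset.mem_range] at hp
    exact ⟨hp.2, (J.release_strictMono k).monotone (by omega)⟩
  have := τ.lt_responseBound_of_last_releases σ hU hσ (q := S.card) (L := t - t₀)
    (d := J.release k j - t₀) g hd (by linarith) ?_ ?_
  · linarith
  · intro l
    have h1 := hwork (t₀ + g l) (hgt l)
    have h2 : ∑ p ∈ S, J.service run (k, p) (t₀ + g l) ≤ S.card * τ.C k := by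
      rw [← nsmul_eq_mul]
      exact Finset.sum_le_card_nsmul _ _ _ fun p _ => hrun.service_le_C (k, p) _
    have h3 : ∑ i, ((R i (t₀ + g l)).card : ℝ) * τ.C (σ i) ≤
        ∑ i, (τ.U (σ i) * g i + if g i < g l then τ.C (σ i) else 0) := by
      refine Finset.sum_le_sum fun i _ => ?_
      have hC := τ.C_pos (σ i)
      by_cases h : (R i t).Nonempty
      · have hc := hcard i h
        split_ifs with hlt
        · have : ((R i (t₀ + g l)).card : ℝ) ≤ (R i t).card := by
            exact_mod_cast Finset.card_le_card (hsub i _ (hgt l))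
          nlinarith
        · have hss : R i (t₀ + g l) ⊂ R i t := by
            refine Finset.ssubset_iff_subset_ne.2 ⟨hsub i _ (hgt l), fun heq => ?_⟩
            have hmem := (R i t).max'_mem h
            have hgi : g i = J.release (σ i) ((R i t).max' h) - t₀ := by simp only [g, dif_pos h]
            generalize (R i t).max' h = p at hmem hgi
            rw [← heq] at hmem
            have := (J.mem_released.1 hmem).2
            linarith
          have : ((R i (t₀ + g l)).card : ℝ) + 1 ≤ (R i t).card := by
            exact_mod_cast Finset.card_lt_card hss
          nlinarith
      · have he : R i (t₀ + g l) = ∅ := by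
          rw [← Finset.subset_empty, ← Finset.not_nonempty_iff_eq_empty.1 h]
          exact hsub i _ (hgt l)
        rw [he, Finset.card_empty, Nat.cast_zero, zero_mul]
        have := mul_nonneg (τ.U_pos (σ i)).le (hgnonneg i)
        split_ifs <;> linarith
    linarith
  · have h1 := hwork t le_rfl
    have h2 : ∑ p ∈ S, J.service run (k, p) t < S.card * τ.C k := by
      -- Strict, because job j is still unfinished at t.
      rw [← nsmul_eq_mul, ← Finset.sum_const]
      exact Finset.sum_lt_sum (fun p _ => hrun.service_le_C (k, p) _)
        ⟨j, hjS, hunf.trans_le (J.exec_le _ _)⟩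
    have h3 : ∑ i, ((R i t).card : ℝ) * τ.C (σ i) ≤
        ∑ i, (τ.U (σ i) * g i + τ.C (σ i)) := by
      refine Finset.sum_le_sum fun i _ => ?_
      by_cases h : (R i t).Nonempty
      · linarith [hcard i h]
      · rw [Finset.not_nonempty_iff_eq_empty.1 h, Finset.card_empty, Nat.cast_zero, zero_mul]
        have := mul_nonneg (τ.U_pos (σ i)).le (hgnonneg i)
        linarith [τ.C_pos (σ i)]
    linarith

lemma worstCaseResponseTime_le_responseBound (hσ : Antitone fun i : Fin m => τ.T (σ i)) :
    τ.worstCaseResponseTime k ≤ ((τ.responseBound k σ : ℝ) : EReal) := by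
  refine iSup_le fun J => iSup_le fun run => iSup_le fun hrun => iSup_le fun j => ?_
  have hB := τ.responseBound_nonneg σ hU
  have hfin : J.finishingTime run (k, j) ≤
      ((J.release k j + τ.responseBound k σ : ℝ) : EReal) := by
    refine sInf_le ⟨_, ⟨by simpa using hB, ?_⟩, rfl⟩
    by_contra! hunf
    have := τ.sub_release_lt_responseBound σ hU hσ hrun (by linarith) hunf
    linarith
  refine (EReal.sub_le_sub hfin le_rfl).trans ?_
  rw [← EReal.coe_sub]
  simp

end Bound

end TaskSystem

theorem theorem2 {n : ℕ} (τ : TaskSystem n) (k : Fin n)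
    {m : ℕ} (σ : Fin m ≃ τ.hp k) (hσ : Antitone fun i : Fin m => τ.T (σ i))
    (hU : ∑ i, τ.U (σ i) + τ.U k ≤ 1) :
    τ.worstCaseResponseTime k ≤ ((τ.responseBound k σ : ℝ) : EReal) ∧
      τ.responseBound k σ ≤ τ.biniBound k σ ∧
      (2 ≤ m → τ.responseBound k σ < τ.biniBound k σ) :=
  ⟨τ.worstCaseResponseTime_le_responseBound σ hU hσ, τ.responseBound_le_biniBound σ hU,
    τ.responseBound_lt_biniBound σ hU⟩
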